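/- Let $k \ge 1$ be an integer, let $w$ be a positive even integer, and let $p_1, p_2$ be primes with $p_1 \equiv 1 \pmod 4$ and $p_2 \equiv 3 \pmod 4$ such that $$p_1 p_2 = 4 w^{2^k} - x^2$$ for some integer $x$ with $|x| \le 2 w^{2^{k-1}} - 2$ (equivalently, $p_1 + p_2 = 4 w^{2^{k-1}}$ and $\{p_1, p_2\} = \{2w^{2^{k-1}} + x,\ 2w^{2^{k-1}} - x\}$). Then the $2$-class group (the Sylow $2$-subgroup of the ideal class group) of $\mathbf{Q}(\sqrt{-p_1 p_2})$ is cyclic of exact order $2^k$ if and only if $$\Bigl(\frac{p_1}{w}\Bigr) = -1,$$ where $(p_1/w)$ is the Kronecker symbol: for $w = 2^e m$ with $m$ odd, $(p_1/w) = (p_1/2)^e (p_1/m)$, where $(p_1/m)$ is the Jacobi symbol and $(p_1/2)$ equals $1$ if $p_1 \equiv \pm 1 \pmod 8$ and $-1$ if $p_1 \equiv \pm 3 \pmod 8$. -/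

import Mathlib

/-- The Kronecker symbol `(a / n)` for an integer `a` and a natural number `n`.
For `n = 2 ^ e * m` with `m` odd it is `(a / 2) ^ e * (a / m)`, where `(a / m)` is the Jacobi
symbol and `(a / 2)` is `0` if `a` is even, `1` if `a ≡ ± 1 (mod 8)`, and `-1` if `a ≡ ± 3 (mod 8)`
(which is Mathlib's character `ZMod.χ₈`). Mathlib's `jacobiSym a n` differs from this when `n` is
even. The symbol `(a / 0)` is `1` if `a = ± 1`, and `0` otherwise. -/
def kroneckerSymbol (a : ℤ) (n : ℕ) : ℤ :=
  if n = 0 then (if a.natAbs = 1 then 1 else 0)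
  else ZMod.χ₈ (a : ZMod 8) ^ padicValNat 2 n * jacobiSym a (n / 2 ^ padicValNat 2 n)

/-- The imaginary quadratic field `ℚ(√(-d))`, as a subfield of `ℂ`, for a natural number `d`
(with `√(-d) = √d * i`). -/
noncomputable def imaginaryQuadraticField (d : ℕ) : IntermediateField ℚ ℂ :=
  IntermediateField.adjoin ℚ {(Real.sqrt (d : ℝ) : ℂ) * Complex.I}

/-! ### Finite abelian groups with few elements of order two -/

/-! Write `p₁p₂ = 4e - 1` and `x = 2c + 1`, and let `ω = (1 + √(-p₁p₂))/2`, which with `1` spans the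
ring of integers. Then `c + ω` has norm `w ^ 2 ^ k` and is coprime to its conjugate, so it generates
`I ^ 2 ^ k` for an ideal `I` of norm `w`. The bound on `x` gives `p₁p₂ > 4 w ^ 2 ^ (k - 1)`, so an
element of norm `w ^ 2 ^ (k - 1)` is a rational integer, and none of these can generate `I ^ 2 ^ (k
- 1)`: the class of `I` has order exactly `2 ^ k` (`orderOf_idealClass_eq`).

Only two primes ramify and their classes coincide, so there is at most one class of order two
(`eq_one_or_eq_of_sq_eq_one`) and the Sylow subgroup is cyclic. It is generated by `[I]` if and only
if `[I]` is not a square. The genus character `J ↦ (N J / p₁)` is trivial on squares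
(`isSquare_absNorm_of_isSquare`), so `(w / p₁) = -1` makes `[I]` a non-square. Conversely, if `[I]`
generates the Sylow subgroup and `w` is a residue, the character is trivial on all ideals of norm
prime to `p₁`, which a split prime that is a non-residue modulo `p₁` refutes. Reciprocity turns `(w
/ p₁)` into `(p₁ / w)`. -/

/-- A finite abelian `2`-group with at most one element of order two is generated by any
non-square. -/
theorem zpowers_eq_top_of_not_isSquare {G : Type*} [CommGroup G] [Finite G] (hG : IsPGroup 2 G)
    (t : G) (ht : ∀ c : G, c ^ 2 = 1 → c = 1 ∨ c = t) {g : G} (hg : ¬ IsSquare g) :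
    Subgroup.zpowers g = ⊤ := by
  have hker : Nat.card (powMonoidHom 2 : G →* G).ker ≤ 2 := by
    have hsub : ((powMonoidHom 2 : G →* G).ker : Set G) ⊆ {1, t} := fun c hc => by
      simpa using ht c (by simpa using hc)
    have h2 := Set.ncard_le_ncard hsub (Set.toFinite _)
    have h3 := Set.ncard_insert_le (1 : G) {t}
    rw [Set.ncard_singleton] at h3
    exact (h2.trans h3)
  have hindex : (powMonoidHom 2 : G →* G).range.index ≤ 2 := by
    have h1 := Subgroup.card_mul_index (powMonoidHom 2 : G →* G).ker
    have h2 := Subgroup.card_mul_index (powMonoidHom 2 : G →* G).range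
    rw [Subgroup.index_ker] at h1
    have h3 : 0 < Nat.card (powMonoidHom 2 : G →* G).range := Nat.card_pos
    nlinarith
  have hrange : ∀ x : G, x ∈ (powMonoidHom 2 : G →* G).range ↔ IsSquare x := fun x => by
    simp [MonoidHom.mem_range, isSquare_iff_exists_sq, eq_comm]
  have hindex' : (powMonoidHom 2 : G →* G).range.index = 2 := by
    have h0 : (powMonoidHom 2 : G →* G).range.index ≠ 0 := Subgroup.index_ne_zero_of_finite
    have h1 : (powMonoidHom 2 : G →* G).range.index ≠ 1 := fun h => by
      rw [Subgroup.index_eq_one] at h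
      exact hg ((hrange g).1 (h ▸ Subgroup.mem_top g))
    lia
  -- Modulo squares there are only the cosets of `1` and `g`. Iterating leaves a factor `y ^ 2 ^ n`,
  -- which is trivial once `2 ^ n` is the group order.
  have step : ∀ x : G, ∃ (i : ℤ) (y : G), x = g ^ i * y ^ 2 := fun x => by
    by_cases hx : IsSquare x
    · obtain ⟨y, rfl⟩ := isSquare_iff_exists_sq x |>.1 hx
      exact ⟨0, y, by simp⟩
    · have := (Subgroup.mul_mem_iff_of_index_two hindex' (a := g⁻¹) (b := x)).2 (by
        rw [inv_mem_iff, hrange, hrange]; tauto)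
      rw [hrange, isSquare_iff_exists_sq] at this
      obtain ⟨y, hy⟩ := this
      exact ⟨1, y, by rw [← hy]; simp⟩
  have iter : ∀ (n : ℕ) (x : G), ∃ (i : ℤ) (y : G), x = g ^ i * y ^ 2 ^ n := fun n => by
    induction n with
    | zero => exact fun x => ⟨0, x, by simp⟩
    | succ n ih =>
      intro x
      obtain ⟨i, y, rfl⟩ := ih x
      obtain ⟨j, z, rfl⟩ := step y
      refine ⟨i + j * 2 ^ n, z, ?_⟩
      rw [mul_pow, zpow_add, zpow_mul g j, ← pow_mul z, pow_succ', mul_assoc]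
      norm_cast
  obtain ⟨n, hn⟩ := IsPGroup.iff_card.1 hG
  refine (Subgroup.eq_top_iff' _).2 fun x => ?_
  obtain ⟨i, y, rfl⟩ := iter n x
  rw [← hn, pow_card_eq_one', mul_one]
  exact Subgroup.zpow_mem_zpowers g i

theorem Sylow.mem_of_orderOf_eq_prime_pow {G : Type*} [CommGroup G] [Finite G] {p : ℕ}
    [Fact p.Prime] (P : Sylow p G) {a : G} {k : ℕ} (ha : orderOf a = p ^ k) : a ∈ P := by
  obtain ⟨Q, hQ⟩ := (IsPGroup.of_card (n := k) (by rw [Nat.card_zpowers, ha]) :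
    IsPGroup p (Subgroup.zpowers a)).exists_le_sylow
  have := Sylow.unique_of_normal P (by infer_instance)
  rw [Subsingleton.elim P Q]
  exact hQ (Subgroup.mem_zpowers a)

/-- If `a` generates the Sylow `2`-subgroup of a finite abelian group then the squares and their
translate by `a` exhaust the group. -/
theorem isSquare_or_isSquare_mul_of_orderOf_eq_card_sylow {G : Type*} [CommGroup G] [Finite G]
    (P : Sylow 2 G) {a : G} {k : ℕ} (ha : orderOf a = 2 ^ k) (hP : Nat.card P = 2 ^ k) (s : G) :
    IsSquare s ∨ IsSquare (s * a) := by
  have haP : a ∈ P := P.mem_of_orderOf_eq_prime_pow ha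
  have hzp : Subgroup.zpowers a = (P : Subgroup G) := by
    refine Subgroup.eq_of_le_of_card_ge ((Subgroup.zpowers_le).2 haP) ?_
    rw [Nat.card_zpowers, ha]
    exact hP.le
  have hodd : Odd (P : Subgroup G).index := by
    have := P.not_dvd_index
    exact Nat.odd_iff.2 (by lia)
  obtain ⟨m, hm⟩ := hodd
  have hs : s ^ (P : Subgroup G).index ∈ (P : Subgroup G) := Subgroup.pow_index_mem _ s
  rw [← hzp, Subgroup.mem_zpowers_iff] at hs
  obtain ⟨j, hj⟩ := hs
  -- The index of `P` is odd, say `2m + 1`, and `s ^ (2m + 1) = a ^ j`.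
  have hs' : s = a ^ j * (s ^ (-(m : ℤ))) ^ (2 : ℤ) := by
    have hj' : a ^ j = s ^ (2 * m + 1) := by rw [hj, hzp, hm]
    rw [hj', ← zpow_mul, ← zpow_natCast, ← zpow_add]
    push_cast
    ring_nf
    simp
  have hsq : IsSquare ((s ^ (-(m : ℤ))) ^ (2 : ℤ)) := ⟨s ^ (-(m : ℤ)), zpow_two _⟩
  rcases Int.even_or_odd j with hj' | hj'
  · left
    rw [hs']
    exact (hj'.isSquare_zpow a).mul hsq
  · right
    rw [hs', mul_right_comm, ← zpow_add_one]
    exact ((hj'.add_one).isSquare_zpow a).mul hsq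

/-! ### Quadratic residues -/

/-- If `p ∤ m`, reduce modulo `p` and divide by `(2m)²`. If `p ∣ m`, then `p ∣ a`, and as `p`
divides `d` exactly once also `p ∣ b`; cancel `p²` and descend on `|m|`. -/
theorem isSquare_zmod_of_four_mul_mul_sq_eq {p : ℕ} (hp : p.Prime) (hp2 : p ≠ 2) {d n : ℤ}
    (hpd : (p : ℤ) ∣ d) (hpd2 : ¬ (p : ℤ) ^ 2 ∣ d) :
    ∀ m a b : ℤ, m ≠ 0 → 4 * n * m ^ 2 = a ^ 2 + d * b ^ 2 → IsSquare (n : ZMod p) := by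
  have hpz := Nat.prime_iff_prime_int.1 hp
  have hp0 : (p : ℤ) ≠ 0 := hpz.ne_zero
  obtain ⟨d', rfl⟩ := hpd
  have hd' : ¬ (p : ℤ) ∣ d' := fun ⟨c, hc⟩ => hpd2 ⟨c, by rw [hc]; ring⟩
  intro m
  induction hN : m.natAbs using Nat.strong_induction_on generalizing m with
  | _ N ih =>
  intro a b hm h
  by_cases hpm : (p : ℤ) ∣ m
  · obtain ⟨m, rfl⟩ := hpm
    have ha : (p : ℤ) ∣ a := hpz.dvd_of_dvd_pow
      (n := 2) ⟨4 * n * p * m ^ 2 - d' * b ^ 2, by linear_combination -h⟩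
    obtain ⟨a, rfl⟩ := ha
    have hb : (p : ℤ) ∣ d' * b ^ 2 :=
      ⟨4 * n * m ^ 2 - a ^ 2, mul_left_cancel₀ hp0 (by linear_combination -h)⟩
    obtain ⟨b, rfl⟩ := hpz.dvd_of_dvd_pow ((hpz.dvd_or_dvd hb).resolve_left hd')
    have hm' : m ≠ 0 := right_ne_zero_of_mul hm
    refine ih m.natAbs ?_ m rfl a b hm'
      (mul_left_cancel₀ (pow_ne_zero 2 hp0) (by linear_combination h))
    rw [← hN, Int.natAbs_mul, Int.natAbs_natCast]
    have := hp.two_le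
    have : 0 < m.natAbs := Int.natAbs_pos.2 hm'
    nlinarith
  · have := Fact.mk hp
    have hm0 : (m : ZMod p) ≠ 0 := by rwa [Ne, ZMod.intCast_zmod_eq_zero_iff_dvd]
    have h20 : (2 : ZMod p) ≠ 0 := by
      intro h2
      have := (ZMod.natCast_eq_zero_iff 2 p).1 (by exact_mod_cast h2)
      exact hp2 ((Nat.prime_dvd_prime_iff_eq hp Nat.prime_two).1 this)
    have h' := congrArg (Int.cast : ℤ → ZMod p) h
    push_cast at h'
    rw [ZMod.natCast_self] at h'
    refine ⟨a / (2 * m), ?_⟩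
    field_simp
    linear_combination h'

/-- Reciprocity for the odd part of `w`, and the supplementary law for its power of two. -/
theorem kroneckerSymbol_eq_jacobiSym {p w : ℕ} (hp : p % 4 = 1) (hw : w ≠ 0) :
    kroneckerSymbol p w = jacobiSym w p := by
  have hodd : Odd p := Nat.odd_iff.2 (Nat.odd_of_mod_four_eq_one hp)
  have hm : Odd (w / 2 ^ padicValNat 2 w) := by
    rw [Nat.odd_iff]
    have := Nat.not_dvd_ordCompl Nat.prime_two hw
    rw [Nat.factorization_def _ Nat.prime_two] at this
    lia
  rw [kroneckerSymbol, if_neg hw, jacobiSym.quadratic_reciprocity_one_mod_four hp hm,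
    Int.cast_natCast, ← jacobiSym.at_two hodd, ← jacobiSym.pow_left, ← jacobiSym.mul_left]
  congr 1
  have := Nat.mul_div_cancel' (pow_padicValNat_dvd (p := 2) (n := w))
  exact_mod_cast this

theorem kroneckerSymbol_eq_neg_one_iff {p w : ℕ} [Fact p.Prime] (hp : p % 4 = 1) (hw : w ≠ 0) :
    kroneckerSymbol p w = -1 ↔ ¬ IsSquare (w : ZMod p) := by
  rw [kroneckerSymbol_eq_jacobiSym hp hw, ← jacobiSym.legendreSym.to_jacobiSym,
    legendreSym.eq_neg_one_iff, Int.cast_natCast]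

/-- There is an odd prime that is a non-residue modulo `p₁` and modulo which `-p₁p₂` is a residue. -/
theorem exists_prime_not_isSquare_and_dvd_sq_add {p₁ p₂ : ℕ} (hp₁ : p₁.Prime) (hp₂ : p₂.Prime)
    (h₁ : p₁ % 4 = 1) (h₂ : p₂ % 4 = 3) :
    ∃ q : ℕ, q.Prime ∧ q ≠ 2 ∧ q ≠ p₁ ∧ q ≠ p₂ ∧ ¬ IsSquare (q : ZMod p₁) ∧
      ∃ r : ℤ, (q : ℤ) ∣ r ^ 2 + p₁ * p₂ := by
  have := Fact.mk hp₁
  have := Fact.mk hp₂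
  have hne : p₁ ≠ p₂ := by rintro rfl; lia
  obtain ⟨u, hu⟩ := FiniteField.exists_nonsquare (F := ZMod p₁) (by rw [ZMod.ringChar_zmod_n]; lia)
  have hcop : Nat.Coprime p₁ p₂ := (Nat.coprime_primes hp₁ hp₂).2 hne
  have hc1 : Nat.Coprime 4 p₁ :=
    Nat.Coprime.pow_left 2 ((Nat.coprime_primes Nat.prime_two hp₁).2 (by rintro rfl; lia))
  have hc2 : Nat.Coprime 4 p₂ :=
    Nat.Coprime.pow_left 2 ((Nat.coprime_primes Nat.prime_two hp₂).2 (by rintro rfl; lia))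
  have hc3 : Nat.Coprime 4 (p₁ * p₂) := hc1.mul_right hc2
  -- The prime is sought with `q ≡ 1` modulo `4`, `q ≡ u` modulo `p₁` and `q ≡ -1` modulo `p₂`. It
  -- is a non-residue modulo both primes, as `p₂ ≡ 3 (mod 4)`; hence `(-p₁p₂ / q) = 1 · (-1) · (-1)
  -- = 1`.
  obtain ⟨c, hcu, hcm⟩ := Nat.chineseRemainder hcop u.val (p₂ - 1)
  obtain ⟨s, hs4, hsc⟩ := Nat.chineseRemainder hc3 1 c
  have hs1 : s ≡ u.val [MOD p₁] := (hsc.of_mul_right p₂).trans hcu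
  have hs2 : s ≡ p₂ - 1 [MOD p₂] := (hsc.of_mul_left p₁).trans hcm
  have e1 : (s : ZMod p₁) = u := by
    rw [(ZMod.natCast_eq_natCast_iff _ _ _).2 hs1, ZMod.natCast_zmod_val]
  have e2 : (s : ZMod p₂) = -1 := by
    rw [(ZMod.natCast_eq_natCast_iff _ _ _).2 hs2, Nat.cast_sub hp₂.one_lt.le]
    simp
  have hscop : s.Coprime (4 * (p₁ * p₂)) := by
    refine Nat.Coprime.mul_right ?_ (Nat.Coprime.mul_right ?_ ?_)
    · exact Nat.ModEq.gcd_eq hs4 |>.trans (by simp)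
    · rw [Nat.coprime_comm, hp₁.coprime_iff_not_dvd, ← ZMod.natCast_eq_zero_iff, e1]
      rintro rfl
      exact hu ⟨0, by simp⟩
    · rw [Nat.coprime_comm, hp₂.coprime_iff_not_dvd, ← ZMod.natCast_eq_zero_iff, e2]
      simp
  obtain ⟨q, hq, hqp, hqs⟩ := Nat.forall_exists_prime_gt_and_modEq (p₁ + p₂ + 2)
    (mul_ne_zero four_ne_zero (mul_ne_zero hp₁.ne_zero hp₂.ne_zero)) hscop
  have := Fact.mk hqp
  have hq4 : q % 4 = 1 := (hqs.of_mul_right _).trans hs4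
  have f1 : (q : ZMod p₁) = u := by
    rw [← e1, ZMod.natCast_eq_natCast_iff]
    exact (hqs.of_mul_left 4).of_mul_right p₂
  have f2 : (q : ZMod p₂) = -1 := by
    rw [← e2, ZMod.natCast_eq_natCast_iff]
    exact (hqs.of_mul_left 4).of_mul_left p₁
  have g1 : legendreSym p₁ q = -1 := by
    rw [legendreSym.eq_neg_one_iff, Int.cast_natCast, f1]
    exact hu
  have g2 : legendreSym p₂ q = -1 := by
    rw [legendreSym.eq_neg_one_iff, Int.cast_natCast, f2, ZMod.exists_sq_eq_neg_one_iff]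
    lia
  refine ⟨q, hqp, by lia, by lia, by lia, by rwa [f1], ?_⟩
  have k1 : legendreSym q p₁ = -1 := by
    rw [← g1, legendreSym.quadratic_reciprocity_one_mod_four hq4 (by rintro rfl; lia)]
  have k2 : legendreSym q p₂ = -1 := by
    rw [← g2, legendreSym.quadratic_reciprocity_one_mod_four hq4 (by rintro rfl; lia)]
  have k3 : legendreSym q (-(p₁ * p₂)) = 1 := by
    rw [← neg_one_mul, legendreSym.mul, legendreSym.mul, k1, k2, legendreSym.at_neg_one (by lia),
      ZMod.χ₄_nat_one_mod_four hq4]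
    norm_num
  have hsq : IsSquare ((-(p₁ * p₂) : ℤ) : ZMod q) := by
    by_contra hcon
    rw [← legendreSym.eq_neg_one_iff, k3] at hcon
    norm_num at hcon
  obtain ⟨y, hy⟩ := hsq
  obtain ⟨r, rfl⟩ := ZMod.intCast_surjective y
  refine ⟨r, (ZMod.intCast_zmod_eq_zero_iff_dvd _ q).1 ?_⟩
  push_cast at hy ⊢
  linear_combination -hy

/-! ### Orders generated by `(1 + √(1 - 4e)) / 2` -/

/-- The ring `R` has `ℤ`-basis `1, ω` with `ω ^ 2 = ω - e`. -/
structure IsQuadraticGenerator {R : Type*} [CommRing R] (e : ℤ) (ω : R) : Prop where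
  mul_self : ω * ω = ω - e
  exists_eq : ∀ z : R, ∃ a b : ℤ, z = a + b * ω
  eq_zero : ∀ a b : ℤ, (a : R) + b * ω = 0 → a = 0 ∧ b = 0

namespace IsQuadraticGenerator

variable {R : Type*} [CommRing R] {e : ℤ} {ω : R}

theorem ext (h : IsQuadraticGenerator e ω) {a b a' b' : ℤ}
    (heq : (a : R) + b * ω = a' + b' * ω) : a = a' ∧ b = b' := by
  have := h.eq_zero (a - a') (b - b') (by push_cast; linear_combination heq)
  lia

theorem intCast_ne_zero (h : IsQuadraticGenerator e ω) {t : ℤ} (ht : t ≠ 0) : (t : R) ≠ 0 :=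
  fun h0 => ht (h.eq_zero t 0 (by simpa using h0)).1

theorem intCast_dvd_iff (h : IsQuadraticGenerator e ω) {n a b : ℤ} :
    (n : R) ∣ a + b * ω ↔ n ∣ a ∧ n ∣ b := by
  constructor
  · rintro ⟨z, hz⟩
    obtain ⟨c, d, rfl⟩ := h.exists_eq z
    have := h.ext (a' := n * c) (b' := n * d) (by rw [hz]; push_cast; ring)
    exact ⟨⟨c, this.1⟩, ⟨d, this.2⟩⟩
  · rintro ⟨⟨c, rfl⟩, ⟨d, rfl⟩⟩
    exact ⟨c + d * ω, by push_cast; ring⟩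

theorem intCast_dvd_intCast (h : IsQuadraticGenerator e ω) {n a : ℤ} :
    (n : R) ∣ a ↔ n ∣ a := by
  simpa using h.intCast_dvd_iff (n := n) (a := a) (b := 0)

/-- Conjugation sends `ω` to `1 - ω`. -/
theorem mul_conj (h : IsQuadraticGenerator e ω) (a b : ℤ) :
    ((a : R) + b * ω) * (a + b - b * ω) = ((a ^ 2 + a * b + e * b ^ 2 : ℤ) : R) := by
  push_cast
  linear_combination (-(b : R) ^ 2) * h.mul_self

theorem sqrt_mul_self (h : IsQuadraticGenerator e ω) :
    (2 * ω - 1) * (2 * ω - 1) = ((1 - 4 * e : ℤ) : R) := by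
  push_cast
  linear_combination 4 * h.mul_self

/-- The basis `1, ω`. -/
noncomputable def basis (h : IsQuadraticGenerator e ω) : Module.Basis (Fin 2) ℤ R :=
  Module.Basis.mk (v := ![1, ω])
    (LinearIndependent.pair_iff.2 fun a b hab => h.eq_zero a b (by simpa using hab))
    (fun z _ => by
      obtain ⟨a, b, rfl⟩ := h.exists_eq z
      rw [Matrix.range_cons, Matrix.range_cons, Matrix.range_empty, Set.union_empty,
        Set.singleton_union, Submodule.mem_span_pair]
      exact ⟨a, b, by simp⟩)

theorem basis_zero (h : IsQuadraticGenerator e ω) : h.basis 0 = 1 := by simp [basis]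

theorem basis_one (h : IsQuadraticGenerator e ω) : h.basis 1 = ω := by simp [basis]

theorem repr_eq (h : IsQuadraticGenerator e ω) (a b : ℤ) :
    h.basis.repr (a + b * ω) = Finsupp.single 0 a + Finsupp.single 1 b := by
  have : (a : R) + b * ω = a • h.basis 0 + b • h.basis 1 := by
    simp [basis_zero, basis_one]
  rw [this]
  simp [-zsmul_eq_mul]

theorem norm_eq (h : IsQuadraticGenerator e ω) (a b : ℤ) :
    Algebra.norm ℤ ((a : R) + b * ω) = a ^ 2 + a * b + e * b ^ 2 := by
  have h0 : ((a : R) + b * ω) * h.basis 0 = a + b * ω := by rw [basis_zero, mul_one]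
  have h1 : ((a : R) + b * ω) * h.basis 1 = (-(e * b) : ℤ) + (a + b : ℤ) * ω := by
    rw [basis_one]
    push_cast
    linear_combination (b : R) * h.mul_self
  rw [Algebra.norm_eq_matrix_det h.basis, Matrix.det_fin_two]
  simp only [Algebra.leftMulMatrix_eq_repr_mul, h0, h1, repr_eq]
  simp
  ring

theorem free (h : IsQuadraticGenerator e ω) : Module.Free ℤ R := .of_basis h.basis

theorem finite (h : IsQuadraticGenerator e ω) : Module.Finite ℤ R := .of_basis h.basis

theorem four_mul_absNorm_span [IsDedekindDomain R] [Module.Free ℤ R]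
    (h : IsQuadraticGenerator e ω) (he : 0 < 4 * e - 1) (a b : ℤ) :
    4 * (Ideal.absNorm (Ideal.span {(a : R) + b * ω}) : ℤ) =
      (2 * a + b) ^ 2 + (4 * e - 1) * b ^ 2 := by
  have := h.finite
  rw [Ideal.absNorm_span_singleton, h.norm_eq, Int.natCast_natAbs, abs_of_nonneg]
  · ring
  · linarith [sq_nonneg (2 * a + b), mul_nonneg he.le (sq_nonneg b)]

/-- If `q ∤ 1 - 4e` then `(q)` is a radical ideal. -/
theorem intCast_dvd_of_dvd_sq (h : IsQuadraticGenerator e ω) {q : ℤ} (hq : Prime q)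
    (hqe : ¬ q ∣ 4 * e - 1) {z : R} (hz : (q : R) ∣ z ^ 2) : (q : R) ∣ z := by
  obtain ⟨a, b, rfl⟩ := h.exists_eq z
  have heq : ((a : R) + b * ω) ^ 2 = (a ^ 2 - e * b ^ 2 : ℤ) + (b * (2 * a + b) : ℤ) * ω := by
    push_cast
    linear_combination (b : R) ^ 2 * h.mul_self
  rw [heq, h.intCast_dvd_iff] at hz
  obtain ⟨h1, h2⟩ := hz
  rw [h.intCast_dvd_iff]
  have hb : q ∣ b → q ∣ a ∧ q ∣ b := fun hb => by
    refine ⟨hq.dvd_of_dvd_pow (n := 2) ?_, hb⟩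
    have := dvd_add h1 ((hb.mul_left (e * b)))
    rwa [show a ^ 2 - e * b ^ 2 + e * b * b = a ^ 2 by ring] at this
  rcases hq.dvd_or_dvd h2 with h3 | ⟨c, hc⟩
  · exact hb h3
  -- Here `b ≡ -2a`, so `a² - e b² ≡ -(4e - 1) a²` modulo `q`.
  · have h4 : q ∣ (4 * e - 1) * a ^ 2 := by
      obtain ⟨f, hf⟩ := h1
      refine ⟨-f - e * (q * c ^ 2 - 4 * a * c), ?_⟩
      obtain rfl : b = q * c - 2 * a := by linarith
      linear_combination -hf
    have h5 := hq.dvd_of_dvd_pow ((hq.dvd_or_dvd h4).resolve_left hqe)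
    refine hb ?_
    have := dvd_sub (Dvd.intro c hc.symm) (h5.mul_left 2)
    simpa using this

/-- The ideal `(q, √(1 - 4e))`. -/
def ramifiedIdeal (_h : IsQuadraticGenerator e ω) (q : ℤ) : Ideal R :=
  Ideal.span {(q : R), 2 * ω - 1}

theorem ramifiedIdeal_ne_bot (h : IsQuadraticGenerator e ω) {q : ℤ} (hq : q ≠ 0) :
    h.ramifiedIdeal q ≠ ⊥ := fun h0 => by
  have : (q : R) ∈ h.ramifiedIdeal q := Ideal.subset_span (by simp)
  rw [h0, Ideal.mem_bot] at this
  exact h.intCast_ne_zero hq this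

theorem mem_ramifiedIdeal_of_dvd_sq (h : IsQuadraticGenerator e ω) {q : ℤ} (hq : Prime q)
    (hq2 : Odd q) {z : R} (hz : (q : R) ∣ z ^ 2) : z ∈ h.ramifiedIdeal q := by
  obtain ⟨a, b, rfl⟩ := h.exists_eq z
  have heq : ((a : R) + b * ω) ^ 2 = (a ^ 2 - e * b ^ 2 : ℤ) + (b * (2 * a + b) : ℤ) * ω := by
    push_cast
    linear_combination (b : R) ^ 2 * h.mul_self
  rw [heq, h.intCast_dvd_iff] at hz
  obtain ⟨h1, h2⟩ := hz
  rw [ramifiedIdeal, Ideal.mem_span_pair]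
  rcases hq.dvd_or_dvd h2 with h3 | ⟨c, hc⟩
  · have h4 : q ∣ a := hq.dvd_of_dvd_pow (n := 2) (by
      have := dvd_add h1 ((h3.mul_left (e * b)))
      rwa [show a ^ 2 - e * b ^ 2 + e * b * b = a ^ 2 by ring] at this)
    obtain ⟨c, rfl⟩ := h3
    obtain ⟨d, rfl⟩ := h4
    exact ⟨d + c * ω, 0, by push_cast; ring⟩
  · obtain ⟨m, rfl⟩ := hq2
    -- With `q = 2m + 1`, `-m` inverts `2` modulo `q`, and `2(a + bω) = (2a + b) + b(2ω - 1)` with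
    -- `q ∣ 2a + b`.
    refine ⟨a + b * ω - m * c, -(m * b), ?_⟩
    have hc' := congrArg (Int.cast : ℤ → R) hc
    push_cast at hc' ⊢
    linear_combination (m : R) * hc'

/-- With `√ = 2ω - 1` and `√² = -pp'`, the square is `(p², p√, pp') = p (p, √, p')`, and `p`, `p'`
are coprime. -/
theorem ramifiedIdeal_sq (h : IsQuadraticGenerator e ω) {p p' : ℤ} (hpp : p * p' = 4 * e - 1)
    (hc : IsCoprime p p') : h.ramifiedIdeal p ^ 2 = Ideal.span {(p : R)} := by
  have hpp' := congrArg (Int.cast : ℤ → R) hpp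
  obtain ⟨u, v, huv⟩ := hc
  have huv' := congrArg (Int.cast : ℤ → R) huv
  push_cast at hpp' huv'
  have hsq := h.sqrt_mul_self
  push_cast at hsq
  rw [ramifiedIdeal, sq, Ideal.span_pair_mul_span_pair]
  apply le_antisymm
  · rw [Ideal.span_le]
    rintro z (rfl | rfl | rfl | rfl) <;> rw [SetLike.mem_coe, Ideal.mem_span_singleton]
    · exact dvd_mul_right _ _
    · exact dvd_mul_right _ _
    · exact dvd_mul_left _ _
    · exact ⟨-p', by linear_combination hsq + hpp'⟩
  · rw [Ideal.span_singleton_le_iff_mem]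
    have h1 : (p : R) = u * (p * p) + (-v) * ((2 * ω - 1) * (2 * ω - 1)) := by
      linear_combination (-(p : R)) * huv' + (v : R) * hsq + v * hpp'
    refine (congrArg (· ∈ _) h1).mpr <| Ideal.add_mem _ (Ideal.mul_mem_left _ _ (Ideal.subset_span ?_))
      (Ideal.mul_mem_left _ _ (Ideal.subset_span ?_)) <;> simp

theorem ramifiedIdeal_mul (h : IsQuadraticGenerator e ω) {p p' : ℤ} (hpp : p * p' = 4 * e - 1)
    (hc : IsCoprime p p') :
    h.ramifiedIdeal p * h.ramifiedIdeal p' = Ideal.span {2 * ω - 1} := by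
  have hpp' := congrArg (Int.cast : ℤ → R) hpp
  obtain ⟨u, v, huv⟩ := hc
  have huv' := congrArg (Int.cast : ℤ → R) huv
  push_cast at hpp' huv'
  have hsq := h.sqrt_mul_self
  push_cast at hsq
  rw [ramifiedIdeal, ramifiedIdeal, Ideal.span_pair_mul_span_pair]
  apply le_antisymm
  · rw [Ideal.span_le]
    rintro z (rfl | rfl | rfl | rfl) <;> rw [SetLike.mem_coe, Ideal.mem_span_singleton]
    · exact ⟨-(2 * ω - 1), by linear_combination hpp' + hsq⟩
    · exact dvd_mul_left _ _
    · exact dvd_mul_right _ _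
    · exact dvd_mul_right _ _
  · rw [Ideal.span_singleton_le_iff_mem]
    have h1 : 2 * ω - 1 = u * (p * (2 * ω - 1)) + v * ((2 * ω - 1) * p') := by
      linear_combination (-(2 * ω - 1)) * huv'
    refine (congrArg (· ∈ _) h1).mpr <| Ideal.add_mem _ (Ideal.mul_mem_left _ _ (Ideal.subset_span ?_))
      (Ideal.mul_mem_left _ _ (Ideal.subset_span ?_)) <;> simp

end IsQuadraticGenerator

/-! ### Ideal classes -/

section idealClass

variable {R : Type*} [CommRing R] [IsDedekindDomain R]

open Classical in
/-- The class of a nonzero integral ideal, and the trivial class for the zero ideal. -/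
noncomputable def idealClass (I : Ideal R) : ClassGroup R :=
  if h : I = ⊥ then 1 else ClassGroup.mk0 ⟨I, mem_nonZeroDivisors_iff_ne_zero.2 h⟩

theorem idealClass_mul {I J : Ideal R} (hI : I ≠ ⊥) (hJ : J ≠ ⊥) :
    idealClass (I * J) = idealClass I * idealClass J := by
  have hIJ : I * J ≠ ⊥ := mul_ne_zero hI hJ
  rw [idealClass, idealClass, idealClass, dif_neg hI, dif_neg hJ, dif_neg hIJ, ← map_mul]
  rfl

theorem idealClass_pow {I : Ideal R} (hI : I ≠ ⊥) (n : ℕ) :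
    idealClass (I ^ n) = idealClass I ^ n := by
  have hIn : I ^ n ≠ ⊥ := pow_ne_zero n hI
  rw [idealClass, idealClass, dif_neg hI, dif_neg hIn, ← map_pow]
  rfl

theorem idealClass_eq_one_iff {I : Ideal R} : idealClass I = 1 ↔ ∃ z, I = Ideal.span {z} := by
  rw [idealClass]
  split_ifs with h
  · exact ⟨fun _ => ⟨0, by simpa using h⟩, fun _ => rfl⟩
  · rw [ClassGroup.mk0_eq_one_iff]
    exact ⟨fun ⟨z, hz⟩ => ⟨z, hz⟩, fun ⟨z, hz⟩ => ⟨z, hz⟩⟩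

theorem idealClass_span_singleton (z : R) : idealClass (Ideal.span {z}) = 1 :=
  idealClass_eq_one_iff.2 ⟨z, rfl⟩

theorem exists_idealClass_eq (c : ClassGroup R) : ∃ I : Ideal R, I ≠ ⊥ ∧ idealClass I = c := by
  obtain ⟨⟨I, hI⟩, rfl⟩ := ClassGroup.mk0_surjective c
  have hI' : I ≠ ⊥ := mem_nonZeroDivisors_iff_ne_zero.1 hI
  exact ⟨I, hI', by rw [idealClass, dif_neg hI']⟩

end idealClass

/-! ### Classes of order two, the genus character and split primes. -/

namespace IsQuadraticGenerator

variable {R : Type*} [CommRing R] [IsDedekindDomain R] {e : ℤ} {ω : R}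

theorem idealClass_ramifiedIdeal_sq (h : IsQuadraticGenerator e ω) {p p' : ℤ}
    (hpp : p * p' = 4 * e - 1) (hc : IsCoprime p p') :
    idealClass (h.ramifiedIdeal p) ^ 2 = 1 := by
  have hp : p ≠ 0 := by rintro rfl; lia
  rw [← idealClass_pow (h.ramifiedIdeal_ne_bot hp), h.ramifiedIdeal_sq hpp hc,
    idealClass_span_singleton]

/-- The two ramified ideals multiply to `(2ω - 1)`, so their classes are inverse to each other, and
each has trivial square. -/
theorem idealClass_ramifiedIdeal_eq (h : IsQuadraticGenerator e ω) {p p' : ℤ}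
    (hpp : p * p' = 4 * e - 1) (hc : IsCoprime p p') :
    idealClass (h.ramifiedIdeal p') = idealClass (h.ramifiedIdeal p) := by
  have hp : p ≠ 0 := by rintro rfl; lia
  have hp' : p' ≠ 0 := by rintro rfl; lia
  have h1 : idealClass (h.ramifiedIdeal p) * idealClass (h.ramifiedIdeal p') = 1 := by
    rw [← idealClass_mul (h.ramifiedIdeal_ne_bot hp) (h.ramifiedIdeal_ne_bot hp'),
      h.ramifiedIdeal_mul hpp hc, idealClass_span_singleton]
  have h2 := h.idealClass_ramifiedIdeal_sq hpp hc
  rw [sq] at h2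
  exact mul_left_cancel (h1.trans h2.symm)

theorem span_intCast_dvd_of_sq_eq (h : IsQuadraticGenerator e ω) {q t : ℤ} (hq : Prime q)
    (hqe : ¬ q ∣ 4 * e - 1) (hqt : q ∣ t) {J : Ideal R} (hJ : J ^ 2 = Ideal.span {(t : R)}) :
    Ideal.span {(q : R)} ∣ J := by
  rw [Ideal.dvd_iff_le]
  intro z hz
  rw [Ideal.mem_span_singleton]
  refine h.intCast_dvd_of_dvd_sq hq hqe ?_
  have := Ideal.pow_mem_pow hz 2
  rw [hJ, Ideal.mem_span_singleton] at this
  exact (h.intCast_dvd_intCast.2 hqt).trans this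

theorem ramifiedIdeal_dvd_of_sq_eq (h : IsQuadraticGenerator e ω) {q t : ℤ} (hq : Prime q)
    (hq2 : Odd q) (hqt : q ∣ t) {J : Ideal R} (hJ : J ^ 2 = Ideal.span {(t : R)}) :
    h.ramifiedIdeal q ∣ J := by
  rw [Ideal.dvd_iff_le]
  intro z hz
  refine h.mem_ramifiedIdeal_of_dvd_sq hq hq2 ?_
  have := Ideal.pow_mem_pow hz 2
  rw [hJ, Ideal.mem_span_singleton] at this
  exact (h.intCast_dvd_intCast.2 hqt).trans this

theorem exists_sq_eq_of_span_mul_sq_eq (h : IsQuadraticGenerator e ω) {q t : ℤ} (hq : q ≠ 0)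
    {J : Ideal R} (hJ : (Ideal.span {(q : R)} * J) ^ 2 = Ideal.span {(t : R)}) :
    ∃ s : ℤ, t = q ^ 2 * s ∧ J ^ 2 = Ideal.span {(s : R)} := by
  rw [mul_pow, Ideal.span_singleton_pow] at hJ
  have hdvd : q ^ 2 ∣ t := by
    rw [← h.intCast_dvd_intCast, ← Ideal.mem_span_singleton, Int.cast_pow]
    have hmem : (t : R) ∈ Ideal.span {(q : R) ^ 2} * J ^ 2 := by
      rw [hJ]
      exact Ideal.mem_span_singleton_self _
    have hle : Ideal.span {(q : R) ^ 2} * J ^ 2 ≤ Ideal.span {(q : R) ^ 2} := Ideal.mul_le_left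
    exact hle hmem
  obtain ⟨s, rfl⟩ := hdvd
  refine ⟨s, rfl, ?_⟩
  rw [Int.cast_mul, Int.cast_pow, ← Ideal.span_singleton_mul_span_singleton] at hJ
  have hq0 : Ideal.span {(q : R) ^ 2} ≠ 0 := by
    rw [Ne, Ideal.zero_eq_bot, Ideal.span_singleton_eq_bot]
    exact pow_ne_zero 2 (h.intCast_ne_zero hq)
  exact mul_left_cancel₀ hq0 hJ

/-- An ideal whose square is generated by a rational integer is principal or equivalent to
a ramified prime. -/
theorem idealClass_eq_one_or_of_sq_eq (h : IsQuadraticGenerator e ω) {p p' : ℤ}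
    (hp : Prime p) (hp' : Prime p') (hpp : p * p' = 4 * e - 1) (hc : IsCoprime p p') :
    ∀ (t : ℤ), t ≠ 0 → ∀ J : Ideal R, J ^ 2 = Ideal.span {(t : R)} →
      idealClass J = 1 ∨ idealClass J = idealClass (h.ramifiedIdeal p) := by
  have hodd : Odd (p * p') := by rw [hpp, Int.odd_iff]; lia
  have ht2 := h.idealClass_ramifiedIdeal_sq hpp hc
  -- Stripping one ramified prime from `J` removes a factor `q` from `t` and multiplies the class by
  -- that of the ramified prime. It is stated for general `q` so as to serve both `p` and `p'`.
  have hstep : ∀ q q' : ℤ, Prime q → Odd q → q * q' = 4 * e - 1 → IsCoprime q q' →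
      idealClass (h.ramifiedIdeal q) = idealClass (h.ramifiedIdeal p) →
      ∀ t : ℤ, t ≠ 0 → q ∣ t → ∀ J : Ideal R, J ^ 2 = Ideal.span {(t : R)} →
      (∀ s : ℤ, s ≠ 0 → s.natAbs < t.natAbs → ∀ J : Ideal R, J ^ 2 = Ideal.span {(s : R)} →
        idealClass J = 1 ∨ idealClass J = idealClass (h.ramifiedIdeal p)) →
      idealClass J = 1 ∨ idealClass J = idealClass (h.ramifiedIdeal p) := by
    intro q q' hq hqo hqq hqc hcl t ht hqt J hJ ih
    obtain ⟨J', rfl⟩ := h.ramifiedIdeal_dvd_of_sq_eq hq hqo hqt hJ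
    obtain ⟨s, rfl⟩ := hqt
    have hs : s ≠ 0 := right_ne_zero_of_mul ht
    have hq0 : Ideal.span {(q : R)} ≠ 0 := by
      simpa [Ideal.span_singleton_eq_bot] using h.intCast_ne_zero hq.ne_zero
    have hJ' : J' ^ 2 = Ideal.span {(s : R)} := by
      rw [mul_pow, h.ramifiedIdeal_sq hqq hqc, Int.cast_mul,
        ← Ideal.span_singleton_mul_span_singleton] at hJ
      exact mul_left_cancel₀ hq0 hJ
    have hJ0 : J' ≠ ⊥ := by
      rintro rfl
      rw [Ideal.bot_pow two_ne_zero, eq_comm, Ideal.span_singleton_eq_bot] at hJ'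
      exact h.intCast_ne_zero hs hJ'
    rw [idealClass_mul (h.ramifiedIdeal_ne_bot hq.ne_zero) hJ0, hcl]
    have hlt : s.natAbs < (q * s).natAbs := by
      have := (Int.prime_iff_natAbs_prime.1 hq).two_le
      have := Int.natAbs_pos.2 hs
      rw [Int.natAbs_mul]
      nlinarith
    rcases ih s hs hlt J' hJ' with h1 | h1 <;> rw [h1]
    · right; rw [mul_one]
    · left; rw [← sq, ht2]
  intro t
  induction hN : t.natAbs using Nat.strong_induction_on generalizing t with
  | _ N ih =>
  subst hN
  intro ht J hJ
  by_cases ht1 : t.natAbs = 1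
  · left
    have hu : IsUnit t := Int.isUnit_iff_natAbs_eq.2 ht1
    have : J ^ 2 = ⊤ := by
      rw [hJ, Ideal.span_singleton_eq_top]
      exact hu.map (Int.castRingHom R)
    have hJ1 : J = ⊤ := Ideal.isUnit_iff.1 <|
      (isUnit_pow_iff two_ne_zero).1 (Ideal.isUnit_iff.2 this)
    rw [hJ1, ← Ideal.span_singleton_one, idealClass_span_singleton]
  obtain ⟨q₀, hq₀, hqt₀⟩ := Nat.exists_prime_and_dvd ht1
  have hq : Prime (q₀ : ℤ) := Nat.prime_iff_prime_int.1 hq₀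
  have hqt : (q₀ : ℤ) ∣ t := Int.natCast_dvd.2 hqt₀
  by_cases hqe : (q₀ : ℤ) ∣ 4 * e - 1
  · rw [← hpp, hq.dvd_mul] at hqe
    have ih' : ∀ s : ℤ, s ≠ 0 → s.natAbs < t.natAbs → ∀ J : Ideal R, J ^ 2 = Ideal.span {(s : R)} →
        idealClass J = 1 ∨ idealClass J = idealClass (h.ramifiedIdeal p) :=
      fun s hs hlt J hJ => ih _ hlt s rfl hs J hJ
    rcases hqe with hqe | hqe
    · exact hstep p p' hp (Int.Odd.of_mul_left hodd) hpp hc rfl t ht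
        (((hq.associated_of_dvd hp hqe).dvd_iff_dvd_left).1 hqt) J hJ ih'
    · exact hstep p' p hp' (Int.Odd.of_mul_right hodd) (by rw [mul_comm, hpp]) hc.symm
        (h.idealClass_ramifiedIdeal_eq hpp hc) t ht
        (((hq.associated_of_dvd hp' hqe).dvd_iff_dvd_left).1 hqt) J hJ ih'
  -- An unramified `q` divides `J` as the whole ideal `(q)`: the class is unchanged and `t` loses
  -- `q²`.
  · obtain ⟨J', rfl⟩ := h.span_intCast_dvd_of_sq_eq hq hqe hqt hJ
    have hq0 : Ideal.span {((q₀ : ℤ) : R)} ≠ ⊥ := by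
      simpa only [ne_eq, Ideal.span_singleton_eq_bot] using h.intCast_ne_zero hq.ne_zero
    obtain ⟨s, rfl, hJ'⟩ := h.exists_sq_eq_of_span_mul_sq_eq hq.ne_zero hJ
    have hs : s ≠ 0 := right_ne_zero_of_mul ht
    have hJ0 : J' ≠ ⊥ := by
      rintro rfl
      rw [Ideal.bot_pow two_ne_zero, eq_comm, Ideal.span_singleton_eq_bot] at hJ'
      exact h.intCast_ne_zero hs hJ'
    rw [idealClass_mul hq0 hJ0, idealClass_span_singleton, one_mul]
    refine ih _ ?_ s rfl hs J' hJ'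
    rw [Int.natAbs_mul, Int.natAbs_pow, Int.natAbs_natCast]
    exact lt_mul_of_one_lt_left (Int.natAbs_pos.2 hs) (one_lt_pow₀ hq₀.one_lt two_ne_zero)

/-- When `4e - 1` is a product of two primes the class group has at most one element of order
two. -/
theorem eq_one_or_eq_of_sq_eq_one [Module.Free ℤ R] (h : IsQuadraticGenerator e ω) {p p' : ℤ}
    (hp : Prime p) (hp' : Prime p') (hpp : p * p' = 4 * e - 1) (hc : IsCoprime p p')
    (he : 0 < 4 * e - 1) (c : ClassGroup R) (hc2 : c ^ 2 = 1) :
    c = 1 ∨ c = idealClass (h.ramifiedIdeal p) := by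
  have := h.finite
  have ht2 := h.idealClass_ramifiedIdeal_sq hpp hc
  obtain ⟨I, hI, rfl⟩ := exists_idealClass_eq c
  rw [← idealClass_pow hI, idealClass_eq_one_iff] at hc2
  obtain ⟨γ, hγ⟩ := hc2
  obtain ⟨a, b, rfl⟩ := h.exists_eq γ
  set n : ℕ := Ideal.absNorm I with hn
  have hn0 : n ≠ 0 := by rwa [hn, Ne, Ideal.absNorm_eq_zero_iff]
  have hnorm : (n : ℤ) ^ 2 = a ^ 2 + a * b + e * b ^ 2 := by
    have h1 := h.four_mul_absNorm_span he a b
    rw [← hγ, map_pow, ← hn] at h1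
    push_cast at h1
    linarith
  -- Hilbert 90 by hand: `γ` has norm `n²`, so `δ = n + γ` satisfies `δ² = (2n + Tr γ) γ`. Writing
  -- `(δ) = I J` then gives `J² = (2n + Tr γ)`.
  have hmem : (n : R) + (a + b * ω) ∈ I := by
    refine I.add_mem (Ideal.absNorm_mem I) (Ideal.pow_le_self two_ne_zero ?_)
    rw [hγ]
    exact Ideal.mem_span_singleton_self _
  have hsq : ((n : R) + (a + b * ω)) ^ 2 = ((2 * n + 2 * a + b : ℤ) : R) * (a + b * ω) := by
    have h1 := h.mul_conj a b
    rw [← hnorm] at h1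
    push_cast at h1 ⊢
    linear_combination -h1
  by_cases hδ : (n : R) + (a + b * ω) = 0
  · refine h.idealClass_eq_one_or_of_sq_eq hp hp' hpp hc n (by exact_mod_cast hn0) I ?_
    rw [hγ, ← Ideal.span_singleton_neg]
    congr 2
    push_cast
    linear_combination -hδ
  · obtain ⟨J, hJ⟩ := Ideal.dvd_span_singleton.2 hmem
    have ht0 : 2 * (n : ℤ) + 2 * a + b ≠ 0 := by
      intro h0
      rw [h0, Int.cast_zero, zero_mul] at hsq
      exact hδ (pow_eq_zero_iff two_ne_zero |>.1 hsq)
    have hJ0 : J ≠ ⊥ := by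
      rintro rfl
      rw [Ideal.mul_bot, Ideal.span_singleton_eq_bot] at hJ
      exact hδ hJ
    have hJ2 : J ^ 2 = Ideal.span {((2 * n + 2 * a + b : ℤ) : R)} := by
      have h1 := congrArg (· ^ 2) hJ
      simp only [Ideal.span_singleton_pow, hsq, mul_pow] at h1
      rw [← Ideal.span_singleton_mul_span_singleton, ← hγ, mul_comm] at h1
      exact (mul_left_cancel₀ (pow_ne_zero 2 hI) h1).symm
    have h1 : idealClass I * idealClass J = 1 := by
      rw [← idealClass_mul hI hJ0, ← hJ, idealClass_span_singleton]
    rcases h.idealClass_eq_one_or_of_sq_eq hp hp' hpp hc _ ht0 J hJ2 with h2 | h2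
    · left; rwa [h2, mul_one] at h1
    · right
      rw [h2] at h1
      rw [sq] at ht2
      exact mul_right_cancel (h1.trans ht2.symm)

/-- The genus character: the norm of an ideal in a square class is a square modulo every prime
divisor of the discriminant. -/
theorem isSquare_absNorm_of_isSquare [Module.Free ℤ R] (h : IsQuadraticGenerator e ω)
    (he : 0 < 4 * e - 1) {p : ℕ} (hp : p.Prime) (hp2 : p ≠ 2) (hpe : (p : ℤ) ∣ 4 * e - 1)
    (hpe2 : ¬ (p : ℤ) ^ 2 ∣ 4 * e - 1) {I : Ideal R} (hI : I ≠ ⊥) (hsq : IsSquare (idealClass I)) :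
    IsSquare (Ideal.absNorm I : ZMod p) := by
  have := h.finite
  obtain ⟨c, hc⟩ := hsq
  -- With `[J]` inverse to a square root of `[I]`, the ideal `I J²` is principal, so `4 N(I) N(J)²`
  -- is a value of the norm form.
  obtain ⟨J, hJ, hJc⟩ := exists_idealClass_eq c⁻¹
  have h1 : idealClass (I * J ^ 2) = 1 := by
    rw [idealClass_mul hI (pow_ne_zero 2 hJ), idealClass_pow hJ, hc, hJc]
    group
  obtain ⟨z, hz⟩ := idealClass_eq_one_iff.1 h1
  obtain ⟨a, b, rfl⟩ := h.exists_eq z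
  have h2 := h.four_mul_absNorm_span he a b
  rw [← hz, map_mul, map_pow] at h2
  have := isSquare_zmod_of_four_mul_mul_sq_eq hp hp2 (n := Ideal.absNorm I) hpe hpe2
    (Ideal.absNorm J) (2 * a + b) b (by simpa [Ideal.absNorm_eq_zero_iff] using hJ)
    (by push_cast at h2; linarith)
  simpa using this

/-- A prime `q` not dividing `2(4e - 1)` modulo which `1 - 4e` is a square is the norm of
an ideal. -/
theorem exists_absNorm_eq [Module.Free ℤ R] (h : IsQuadraticGenerator e ω)
    {q : ℕ} (hq : q.Prime) (hq2 : q ≠ 2)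
    (hqe : ¬ (q : ℤ) ∣ 4 * e - 1) {r : ℤ} (hr : (q : ℤ) ∣ r ^ 2 + (4 * e - 1)) :
    ∃ I : Ideal R, I ≠ ⊥ ∧ Ideal.absNorm I = q := by
  have := h.finite
  have hqz := Nat.prime_iff_prime_int.1 hq
  have hndvd : ¬ (q : ℤ) ∣ 2 := fun h2 => by
    have := (Nat.prime_dvd_prime_iff_eq hq Nat.prime_two).1 (by exact_mod_cast h2)
    exact hq2 this
  have hqr : ¬ (q : ℤ) ∣ r := fun h2 => hqe ((dvd_add_right (dvd_pow h2 two_ne_zero)).1 hr)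
  obtain ⟨m, hm⟩ := hr
  have hm' := congrArg (Int.cast : ℤ → R) hm
  have hsq := h.sqrt_mul_self
  push_cast at hm' hsq
  obtain ⟨u, v, huv⟩ := (hqz.coprime_iff_not_dvd (n := 2 * r)).2 fun h2 =>
    (hqz.dvd_or_dvd h2).elim hndvd hqr
  have huv' := congrArg (Int.cast : ℤ → R) huv
  push_cast at huv'
  set I₁ : Ideal R := Ideal.span {(q : R), r + (2 * ω - 1)} with hI₁
  set I₂ : Ideal R := Ideal.span {(q : R), r - (2 * ω - 1)} with hI₂
  have hmul : I₁ * I₂ = Ideal.span {(q : R)} := by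
    rw [hI₁, hI₂, Ideal.span_pair_mul_span_pair]
    apply le_antisymm
    · rw [Ideal.span_le]
      rintro z (rfl | rfl | rfl | rfl) <;> rw [SetLike.mem_coe, Ideal.mem_span_singleton]
      · exact dvd_mul_right _ _
      · exact dvd_mul_right _ _
      · exact dvd_mul_left _ _
      · exact ⟨m, by linear_combination hm' - hsq⟩
    · rw [Ideal.span_singleton_le_iff_mem]
      have h1 : (q : R) = u * (q * q) + v * (q * (r - (2 * ω - 1)) + (r + (2 * ω - 1)) * q) := by
        linear_combination (-(q : R)) * huv'
      refine (congrArg (· ∈ _) h1).mpr <|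
        Ideal.add_mem _ (Ideal.mul_mem_left _ _ (Ideal.subset_span ?_))
        (Ideal.mul_mem_left _ _ (Ideal.add_mem _ (Ideal.subset_span ?_) (Ideal.subset_span ?_))) <;>
      simp
  have hnorm : Ideal.absNorm I₁ * Ideal.absNorm I₂ = q ^ 2 := by
    rw [← map_mul, hmul, Ideal.absNorm_span_singleton]
    have := h.norm_eq q 0
    simp only [Int.cast_natCast, Int.cast_zero, zero_mul, add_zero] at this
    rw [this]
    simp [Int.natAbs_pow]
  -- Were one factor trivial, the other would be `(q)`, and `q` would divide the coefficient `±2` of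
  -- `ω`.
  have hne₁ : Ideal.absNorm I₁ ≠ 1 := fun h1 => by
    rw [Ideal.absNorm_eq_one_iff] at h1
    have h2 : (r : R) - (2 * ω - 1) ∈ I₂ := Ideal.subset_span (by simp)
    rw [h1, Ideal.top_mul] at hmul
    rw [hmul, Ideal.mem_span_singleton] at h2
    have h3 := (h.intCast_dvd_iff (n := q) (a := r + 1) (b := -2)).1 (by
      convert h2 using 1 <;> push_cast <;> ring)
    exact hndvd ((dvd_neg).1 h3.2)
  have hne₂ : Ideal.absNorm I₂ ≠ 1 := fun h1 => by
    rw [Ideal.absNorm_eq_one_iff] at h1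
    have h2 : (r : R) + (2 * ω - 1) ∈ I₁ := Ideal.subset_span (by simp)
    rw [h1, Ideal.mul_top] at hmul
    rw [hmul, Ideal.mem_span_singleton] at h2
    have h3 := (h.intCast_dvd_iff (n := q) (a := r - 1) (b := 2)).1 (by
      convert h2 using 1 <;> push_cast <;> ring)
    exact hndvd h3.2
  have hq1 : Ideal.absNorm I₁ = q := ((Nat.Prime.mul_eq_prime_sq_iff hq hne₁ hne₂).1 hnorm).1
  refine ⟨I₁, fun h0 => hq.ne_zero ?_, hq1⟩
  rw [← hq1, h0, Ideal.absNorm_bot]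

end IsQuadraticGenerator

/-! ### The ring of integers of an imaginary quadratic field -/

theorem exists_intCast_eq_of_isIntegral_ratCast {u : ℚ} (hu : IsIntegral ℤ (u : ℂ)) :
    ∃ a : ℤ, (a : ℚ) = u := by
  have h1 : IsIntegral ℤ u := (isIntegral_algebraMap_iff (algebraMap ℚ ℂ).injective).1 hu
  exact IsIntegrallyClosed.isIntegral_iff.1 h1

/-- `(d v)² = d n`, so `d v` is an integer whose square is divisible by `d`; squarefreeness then
gives `d ∣ d v`. -/
theorem exists_intCast_eq_of_squarefree_mul_sq {d : ℕ} (hd : Squarefree d) {v : ℚ} {n : ℤ}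
    (h : d * v ^ 2 = n) : ∃ a : ℤ, (a : ℚ) = v := by
  have hd0 : (d : ℚ) ≠ 0 := Nat.cast_ne_zero.2 hd.ne_zero
  have h1 : IsIntegral ℤ (d * v : ℚ) := by
    refine IsIntegral.of_pow (n := 2) two_pos ?_
    have : (d * v : ℚ) ^ 2 = ((d * n : ℤ) : ℚ) := by
      push_cast
      rw [← h]
      ring
    rw [this]
    exact isIntegral_algebraMap (R := ℤ) (x := d * n)
  obtain ⟨m, hm⟩ := IsIntegrallyClosed.isIntegral_iff.1 h1
  have hm' : (m : ℚ) = d * v := hm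
  have h2 : (d : ℤ) ∣ m ^ 2 := ⟨n, by
    have : (m : ℚ) ^ 2 = d * n := by rw [hm', ← h]; ring
    exact_mod_cast this⟩
  rw [(Int.squarefree_natCast.2 hd).dvd_pow_iff_dvd two_ne_zero] at h2
  obtain ⟨a, rfl⟩ := h2
  exact ⟨a, mul_left_cancel₀ hd0 (by rw [← hm']; push_cast; ring)⟩

theorem sqrt_mul_I_mul_self (d : ℕ) :
    ((Real.sqrt d : ℂ) * Complex.I) * ((Real.sqrt d : ℂ) * Complex.I) = -d := by
  have h1 : (Real.sqrt d : ℂ) * Real.sqrt d = d := by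
    rw [← Complex.ofReal_mul, Real.mul_self_sqrt (Nat.cast_nonneg d), Complex.ofReal_natCast]
  linear_combination ((Real.sqrt d : ℂ) * Real.sqrt d) * Complex.I_mul_I - h1

theorem isIntegral_sqrt_mul_I (d : ℕ) : IsIntegral ℤ ((Real.sqrt d : ℂ) * Complex.I) := by
  refine IsIntegral.of_pow (n := 2) two_pos ?_
  rw [sq, sqrt_mul_I_mul_self]
  exact (isIntegral_algebraMap (R := ℤ) (x := (d : ℤ))).neg

instance numberField_imaginaryQuadraticField (d : ℕ) :
    NumberField (imaginaryQuadraticField d) where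
  to_finiteDimensional := by
    rw [imaginaryQuadraticField]
    exact IntermediateField.adjoin.finiteDimensional (isIntegral_sqrt_mul_I d).tower_top

theorem mem_imaginaryQuadraticField_iff {d : ℕ} {z : ℂ} :
    z ∈ imaginaryQuadraticField d ↔ ∃ u v : ℚ, z = u + v * ((Real.sqrt d : ℂ) * Complex.I) := by
  set θ : ℂ := (Real.sqrt d : ℂ) * Complex.I with hθ
  have hθ2 : θ * θ = -d := sqrt_mul_I_mul_self d
  constructor
  · intro hz
    rw [imaginaryQuadraticField, ← IntermediateField.mem_toSubalgebra,
      IntermediateField.adjoin_simple_toSubalgebra_of_isAlgebraic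
        (isIntegral_sqrt_mul_I d).tower_top.isAlgebraic] at hz
    induction hz using Algebra.adjoin_induction with
    | mem x hx =>
      rw [Set.mem_singleton_iff] at hx
      exact ⟨0, 1, by simp [hx, hθ]⟩
    | algebraMap r => exact ⟨r, 0, by simp⟩
    | add x y _ _ hx hy =>
      obtain ⟨u, v, rfl⟩ := hx
      obtain ⟨u', v', rfl⟩ := hy
      exact ⟨u + u', v + v', by push_cast; ring⟩
    | mul x y _ _ hx hy =>
      obtain ⟨u, v, rfl⟩ := hx
      obtain ⟨u', v', rfl⟩ := hy
      exact ⟨u * u' - d * (v * v'), u * v' + u' * v, by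
        push_cast
        linear_combination (v * v' : ℂ) * hθ2⟩
  · rintro ⟨u, v, rfl⟩
    have hmem : θ ∈ imaginaryQuadraticField d := IntermediateField.mem_adjoin_simple_self ℚ θ
    have hr : ∀ r : ℚ, (r : ℂ) ∈ imaginaryQuadraticField d := fun r =>
      (imaginaryQuadraticField d).algebraMap_mem r
    exact add_mem (hr u) (mul_mem (hr v) hmem)

/-- The integers of `ℚ(√-d)` for squarefree `d ≡ 3 (mod 4)`. -/
theorem exists_eq_of_isIntegral {d : ℕ} (hd : Squarefree d) (hd4 : d % 4 = 3) {z : ℂ}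
    (hz : z ∈ imaginaryQuadraticField d) (hint : IsIntegral ℤ z) :
    ∃ a b : ℤ, z = a + b * ((1 + (Real.sqrt d : ℂ) * Complex.I) / 2) := by
  obtain ⟨u, v, rfl⟩ := mem_imaginaryQuadraticField_iff.1 hz
  set θ : ℂ := (Real.sqrt d : ℂ) * Complex.I with hθ
  have hθ2 : θ * θ = -d := sqrt_mul_I_mul_self d
  have hconj : (starRingEnd ℂ) (u + v * θ) = u - v * θ := by
    simp [hθ, sub_eq_add_neg]
  have hint' : IsIntegral ℤ ((u : ℂ) - v * θ) := by
    rw [← hconj]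
    exact hint.map (starRingEnd ℂ).toIntAlgHom
  obtain ⟨A, hA⟩ : ∃ A : ℤ, (A : ℚ) = 2 * u := by
    refine exists_intCast_eq_of_isIntegral_ratCast ?_
    have h1 : ((2 * u : ℚ) : ℂ) = (u + v * θ) + (u - v * θ) := by
      push_cast
      ring
    rw [h1]
    exact hint.add hint'
  obtain ⟨B, hB⟩ : ∃ B : ℤ, (B : ℚ) = u ^ 2 + d * v ^ 2 := by
    refine exists_intCast_eq_of_isIntegral_ratCast ?_
    have h1 : ((u ^ 2 + d * v ^ 2 : ℚ) : ℂ) = (u + v * θ) * (u - v * θ) := by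
      push_cast
      linear_combination (v ^ 2 : ℂ) * hθ2
    rw [h1]
    exact hint.mul hint'
  obtain ⟨C, hC⟩ : ∃ C : ℤ, (C : ℚ) = 2 * v := by
    refine exists_intCast_eq_of_squarefree_mul_sq hd (n := 4 * B - A ^ 2) ?_
    push_cast
    rw [hB, hA]
    ring
  have hrel : A ^ 2 + d * C ^ 2 = 4 * B := by
    have : (A : ℚ) ^ 2 + d * C ^ 2 = 4 * B := by rw [hA, hB, hC]; ring
    exact_mod_cast this
  -- As `d` is odd, `A² + d C² = 4B` forces `A ≡ C (mod 2)`; then `z = (A - C)/2 + C (1 + √(-d))/2`.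
  have hpar : Even (A - C) := by
    have hodd : Odd (d : ℤ) := by rw [Int.odd_iff]; lia
    have h2 : Even (A ^ 2 + d * C ^ 2) := ⟨2 * B, by rw [hrel]; ring⟩
    rw [Int.even_add, Int.even_mul, Int.even_pow' two_ne_zero, Int.even_pow' two_ne_zero,
      ← Int.not_odd_iff_even (n := d)] at h2
    rw [Int.even_sub]
    tauto
  obtain ⟨D, hD⟩ := hpar
  refine ⟨D, C, ?_⟩
  have hA' : (A : ℂ) = 2 * u := by exact_mod_cast congrArg (Rat.cast : ℚ → ℂ) hA
  have hC' : (C : ℂ) = 2 * v := by exact_mod_cast congrArg (Rat.cast : ℚ → ℂ) hC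
  have hD' : (A : ℂ) - C = D + D := by exact_mod_cast congrArg (Int.cast : ℤ → ℂ) hD
  linear_combination -(1 / 2 : ℂ) * hA' - (θ / 2) * hC' + (1 / 2 : ℂ) * hD'

theorem exists_isQuadraticGenerator {d : ℕ} (hd : Squarefree d) {e : ℤ} (hde : (d : ℤ) = 4 * e - 1) :
    ∃ ω : NumberField.RingOfIntegers (imaginaryQuadraticField d), IsQuadraticGenerator e ω := by
  have hθ2 := sqrt_mul_I_mul_self d
  have hde' : (d : ℂ) = 4 * e - 1 := by exact_mod_cast congrArg (Int.cast : ℤ → ℂ) hde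
  set ω₀ : ℂ := (1 + (Real.sqrt d : ℂ) * Complex.I) / 2 with hω₀
  have hsq : ω₀ * ω₀ = ω₀ - e := by
    rw [hω₀]
    linear_combination (1 / 4 : ℂ) * hθ2 - (1 / 4 : ℂ) * hde'
  have hmem : ω₀ ∈ imaginaryQuadraticField d :=
    mem_imaginaryQuadraticField_iff.2 ⟨1 / 2, 1 / 2, by rw [hω₀]; push_cast; ring⟩
  have hint : IsIntegral ℤ ω₀ := by
    refine ⟨Polynomial.X ^ 2 - Polynomial.X + Polynomial.C e, by monicity!, ?_⟩
    simp only [Polynomial.eval₂_add, Polynomial.eval₂_sub, Polynomial.eval₂_pow,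
      Polynomial.eval₂_X, Polynomial.eval₂_C]
    rw [sq, hsq]
    simp
  set ω : NumberField.RingOfIntegers (imaginaryQuadraticField d) :=
    ⟨⟨ω₀, hmem⟩, (isIntegral_algebraMap_iff
      (algebraMap (imaginaryQuadraticField d) ℂ).injective).1 hint⟩ with hω
  let f : NumberField.RingOfIntegers (imaginaryQuadraticField d) →+* ℂ :=
    (algebraMap (imaginaryQuadraticField d) ℂ).comp (algebraMap _ _)
  have hf : Function.Injective f :=
    (algebraMap (imaginaryQuadraticField d) ℂ).injective.comp
      NumberField.RingOfIntegers.coe_injective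
  have hfω : f ω = ω₀ := rfl
  refine ⟨ω, ⟨hf ?_, fun z => ?_, fun a b hab => ?_⟩⟩
  · rw [map_mul, map_sub, hfω, map_intCast, hsq]
  · have hzint : IsIntegral ℤ (f z) :=
      (NumberField.RingOfIntegers.isIntegral z).map f.toIntAlgHom
    obtain ⟨a, b, hab⟩ := exists_eq_of_isIntegral hd (by lia) (z := f z)
      (algebraMap (NumberField.RingOfIntegers (imaginaryQuadraticField d))
        (imaginaryQuadraticField d) z).2 hzint
    exact ⟨a, b, hf (by rw [hab, map_add, map_mul, map_intCast, map_intCast, hfω])⟩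
  · have h1 := congrArg f hab
    rw [map_add, map_mul, map_intCast, map_intCast, hfω, map_zero] at h1
    have him := congrArg Complex.im h1
    have hpos : 0 < Real.sqrt d := Real.sqrt_pos.2 (by exact_mod_cast Nat.pos_of_ne_zero hd.ne_zero)
    have hb : b = 0 := by
      simpa [hω₀, hpos.ne'] using him
    subst hb
    exact ⟨by simpa using h1, rfl⟩

/-! ### The class of order `2 ^ k` -/

namespace IsQuadraticGenerator

variable {R : Type*} [CommRing R] [IsDedekindDomain R] {e : ℤ} {ω : R}

/-- If `w ^ n` is the norm of `c + ω` and is prime to the discriminant then `c + ω` generates the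
`n`-th power of an ideal. -/
theorem exists_pow_eq_span (h : IsQuadraticGenerator e ω) {c w : ℤ} {n : ℕ}
    (hw : c ^ 2 + c + e = w ^ n) (hcop : IsCoprime (w ^ n) (4 * e - 1)) :
    ∃ I : Ideal R, I ^ n = Ideal.span {(c : R) + ω} := by
  have hmul : ((c : R) + ω) * (c + 1 - ω) = (w : R) ^ n := by
    have h1 := h.mul_conj c 1
    rw [show c ^ 2 + c * 1 + e * 1 ^ 2 = w ^ n by rw [← hw]; ring] at h1
    push_cast at h1
    linear_combination h1
  -- The two conjugates differ by `2ω - 1`, whose square `1 - 4e` is prime to their product `w ^ n`.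
  have hco : IsCoprime ((c : R) + ω) (c + 1 - ω) := by
    obtain ⟨u, v, huv⟩ := hcop
    have huv' := congrArg (Int.cast : ℤ → R) huv
    have hsq := h.sqrt_mul_self
    push_cast at huv' hsq
    refine ⟨u * (c + 1 - ω) - v * (2 * ω - 1), v * (2 * ω - 1), ?_⟩
    linear_combination huv' + (u : R) * hmul - (v : R) * hsq
  obtain ⟨I, hI⟩ := exists_eq_pow_of_mul_eq_pow_of_coprime
    ((Ideal.isCoprime_span_singleton_iff _ _).2 hco) (c := Ideal.span {(w : R)}) (n := n) (by
      rw [Ideal.span_singleton_mul_span_singleton, hmul, Ideal.span_singleton_pow])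
  exact ⟨I, hI.symm⟩

theorem absNorm_eq_of_pow_eq_span [Module.Free ℤ R] (h : IsQuadraticGenerator e ω)
    (he : 0 < 4 * e - 1) {c : ℤ} {w n : ℕ} (hn : n ≠ 0)
    (hw : c ^ 2 + c + e = (w : ℤ) ^ n) {I : Ideal R}
    (hI : I ^ n = Ideal.span {(c : R) + ω}) : Ideal.absNorm I = w := by
  have := h.finite
  refine Nat.pow_left_injective hn ?_
  have h1 := h.four_mul_absNorm_span he c 1
  rw [Int.cast_one, one_mul, ← hI, map_pow] at h1
  have h2 : ((Ideal.absNorm I ^ n : ℕ) : ℤ) = (w ^ n : ℕ) := by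
    push_cast at h1 ⊢
    rw [← hw]
    linarith
  exact_mod_cast h2

/-- A generator `a + bω` of `I ^ 2 ^ k` satisfies `(2a + b)² + (4e - 1) b² = 4 w ^ 2 ^ k < 4e - 1`,
so `b = 0`. Then `a² = w ^ 2 ^ k` divides `c + ω`, whose `ω`-coefficient is `1`. -/
theorem orderOf_idealClass_eq [Module.Free ℤ R] (h : IsQuadraticGenerator e ω)
    {c : ℤ} {w k : ℕ} (hw2 : 2 ≤ w) (hlt : 4 * (w : ℤ) ^ 2 ^ k < 4 * e - 1) {I : Ideal R}
    (hI0 : I ≠ ⊥) (hnorm : Ideal.absNorm I = w)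
    (hI : I ^ 2 ^ (k + 1) = Ideal.span {(c : R) + ω}) :
    orderOf (idealClass I) = 2 ^ (k + 1) := by
  have := h.finite
  have he : 0 < 4 * e - 1 := lt_of_le_of_lt (by positivity) hlt
  refine orderOf_eq_prime_pow (fun h1 => ?_) ?_
  · rw [← idealClass_pow hI0, idealClass_eq_one_iff] at h1
    obtain ⟨z, hz⟩ := h1
    obtain ⟨a, b, rfl⟩ := h.exists_eq z
    have h2 := h.four_mul_absNorm_span he a b
    rw [← hz, map_pow, hnorm] at h2
    push_cast at h2
    have hb : b = 0 := by
      by_contra hb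
      have h3 : 0 < b ^ 2 := by positivity
      nlinarith [sq_nonneg (2 * a + b)]
    subst hb
    have h4 : a ^ 2 = (w : ℤ) ^ 2 ^ k := by linarith
    rw [pow_succ, pow_mul, hz, Ideal.span_singleton_pow, Ideal.span_singleton_eq_span_singleton]
      at hI
    have h5 : ((a ^ 2 : ℤ) : R) ∣ c + (1 : ℤ) * ω := by
      simpa using hI.dvd
    rw [h.intCast_dvd_iff, h4] at h5
    have h6 : (w : ℤ) ∣ 1 := (dvd_pow_self _ (pow_ne_zero k two_ne_zero)).trans h5.2
    have h7 := Int.le_of_dvd one_pos h6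
    lia
  · rw [← idealClass_pow hI0, hI, idealClass_span_singleton]

end IsQuadraticGenerator

/-! ### The criterion, and the passage from `x` to `c`. -/

theorem isCyclic_and_card_sylow_iff {R : Type*} [CommRing R] [IsDedekindDomain R]
    [Finite (ClassGroup R)] {e : ℤ} {ω : R} (h : IsQuadraticGenerator e ω) {p₁ p₂ w k : ℕ}
    (hp₁ : p₁.Prime) (hp₂ : p₂.Prime) (h₁ : p₁ % 4 = 1) (h₂ : p₂ % 4 = 3)
    (he : (p₁ : ℤ) * p₂ = 4 * e - 1) {c : ℤ} (hw2 : 2 ≤ w)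
    (hw : c ^ 2 + c + e = (w : ℤ) ^ 2 ^ (k + 1)) (hlt : 4 * (w : ℤ) ^ 2 ^ k < 4 * e - 1)
    (hcop : w.Coprime (p₁ * p₂)) (P : Sylow 2 (ClassGroup R)) :
    (IsCyclic P ∧ Nat.card P = 2 ^ (k + 1)) ↔ kroneckerSymbol p₁ w = -1 := by
  have := Fact.mk hp₁
  have := h.free
  have hp₁z := Nat.prime_iff_prime_int.1 hp₁
  have hp₂z := Nat.prime_iff_prime_int.1 hp₂
  have hne : p₁ ≠ p₂ := by rintro rfl; lia
  have hpp : p₁.Coprime p₂ := (Nat.coprime_primes hp₁ hp₂).2 hne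
  have he0 : 0 < 4 * e - 1 := lt_of_le_of_lt (by positivity) hlt
  have hp2 : p₁ ≠ 2 := by rintro rfl; lia
  have hpe : (p₁ : ℤ) ∣ 4 * e - 1 := ⟨p₂, he.symm⟩
  have hpe2 : ¬ (p₁ : ℤ) ^ 2 ∣ 4 * e - 1 := by
    rw [← he, sq, mul_dvd_mul_iff_left hp₁z.ne_zero, Int.natCast_dvd_natCast,
      Nat.prime_dvd_prime_iff_eq hp₁ hp₂]
    exact hne
  have hcop' : IsCoprime ((w : ℤ) ^ 2 ^ (k + 1)) (4 * e - 1) := by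
    rw [← he]
    exact IsCoprime.pow_left (by exact_mod_cast Nat.isCoprime_iff_coprime.2 hcop)
  obtain ⟨I, hI⟩ := h.exists_pow_eq_span hw hcop'
  have hnorm := h.absNorm_eq_of_pow_eq_span he0 (pow_ne_zero _ two_ne_zero) hw hI
  have hI0 : I ≠ ⊥ := by
    rintro rfl
    rw [Ideal.absNorm_bot] at hnorm
    lia
  have hord := h.orderOf_idealClass_eq hw2 hlt hI0 hnorm hI
  rw [kroneckerSymbol_eq_neg_one_iff h₁ (by lia)]
  constructor
  · rintro ⟨-, hcard⟩ hsq
    obtain ⟨q, hq, hq2, hq₁, hq₂, hns, r, hr⟩ :=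
      exists_prime_not_isSquare_and_dvd_sq_add hp₁ hp₂ h₁ h₂
    have hqe : ¬ (q : ℤ) ∣ 4 * e - 1 := by
      rw [← he, ← Nat.cast_mul, Int.natCast_dvd_natCast, hq.dvd_mul,
        Nat.prime_dvd_prime_iff_eq hq hp₁, Nat.prime_dvd_prime_iff_eq hq hp₂]
      tauto
    obtain ⟨Q, hQ0, hQ⟩ := h.exists_absNorm_eq hq hq2 hqe (he ▸ hr)
    -- One of `[Q]`, `[Q I]` is a square, so `q` or `q w` is a residue modulo `p₁`. As `w` is one,
    -- so is `q` in either case.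
    rcases isSquare_or_isSquare_mul_of_orderOf_eq_card_sylow P hord hcard (idealClass Q)
      with h3 | h3
    · have h4 := h.isSquare_absNorm_of_isSquare he0 hp₁ hp2 hpe hpe2 hQ0 h3
      rw [hQ] at h4
      exact hns h4
    · rw [← idealClass_mul hQ0 hI0] at h3
      have h4 := h.isSquare_absNorm_of_isSquare he0 hp₁ hp2 hpe hpe2 (mul_ne_zero hQ0 hI0) h3
      have := h.finite
      rw [map_mul, hQ, hnorm, Nat.cast_mul] at h4
      have hw0 : (w : ZMod p₁) ≠ 0 := by
        rw [Ne, ZMod.natCast_eq_zero_iff, ← hp₁.coprime_iff_not_dvd]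
        exact hcop.symm.coprime_mul_right
      have h5 := h4.mul hsq.inv
      rw [mul_assoc, mul_inv_cancel₀ hw0, mul_one] at h5
      exact hns h5
  · intro hns
    have hnsq : ¬ IsSquare (idealClass I) := fun h3 => hns <| by
      have h4 := h.isSquare_absNorm_of_isSquare he0 hp₁ hp2 hpe hpe2 hI0 h3
      rwa [hnorm] at h4
    have hmem : idealClass I ∈ P := P.mem_of_orderOf_eq_prime_pow hord
    have htwo := h.eq_one_or_eq_of_sq_eq_one hp₁z hp₂z he (Nat.isCoprime_iff_coprime.2 hpp) he0
    have htop : Subgroup.zpowers (⟨idealClass I, hmem⟩ : P) = ⊤ := by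
      have hnsP : ¬ IsSquare (⟨idealClass I, hmem⟩ : P) := fun ⟨y, hy⟩ =>
        hnsq ⟨y, congrArg Subtype.val hy⟩
      by_cases htP : idealClass (h.ramifiedIdeal p₁) ∈ P
      · refine zpowers_eq_top_of_not_isSquare P.isPGroup' ⟨_, htP⟩ (fun c hc => ?_) hnsP
        have := htwo c (congrArg Subtype.val hc)
        exact this.imp (fun h5 => Subtype.ext h5) (fun h5 => Subtype.ext h5)
      · refine zpowers_eq_top_of_not_isSquare P.isPGroup' 1 (fun c hc => ?_) hnsP
        rcases htwo c (congrArg Subtype.val hc) with h5 | h5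
        · exact Or.inl (Subtype.ext h5)
        · exact absurd (h5 ▸ c.2) htP
    refine ⟨⟨⟨_, fun x => htop ▸ Subgroup.mem_top x⟩⟩, ?_⟩
    rw [← hord, ← Subgroup.orderOf_mk _ hmem, ← Nat.card_zpowers, htop, Subgroup.card_top]

theorem mainTheorem4 (k w p₁ p₂ : ℕ) (x : ℤ) (hk : 1 ≤ k)
    (hw : Even w) (hw_pos : 0 < w)
    (hp₁ : p₁.Prime) (hp₂ : p₂.Prime)
    (hp₁_mod : p₁ ≡ 1 [MOD 4]) (hp₂_mod : p₂ ≡ 3 [MOD 4])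
    (hx : |x| ≤ 2 * (w : ℤ) ^ (2 ^ (k - 1)) - 2)
    (h : (p₁ : ℤ) * p₂ = 4 * (w : ℤ) ^ (2 ^ k) - x ^ 2)
    (P : Sylow 2 (ClassGroup (NumberField.RingOfIntegers (imaginaryQuadraticField (p₁ * p₂))))) :
    (IsCyclic P ∧ Nat.card P = 2 ^ k) ↔ kroneckerSymbol p₁ w = -1 := by
  obtain ⟨k, rfl⟩ := Nat.exists_eq_add_of_le' hk
  rw [Nat.add_sub_cancel] at hx
  have hw2 : 2 ≤ w := Nat.le_of_dvd hw_pos hw.two_dvd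
  have h₁ : p₁ % 4 = 1 := hp₁_mod
  have h₂ : p₂ % 4 = 3 := hp₂_mod
  have hne : p₁ ≠ p₂ := by rintro rfl; lia
  have hsf : Squarefree (p₁ * p₂) :=
    (Nat.squarefree_mul ((Nat.coprime_primes hp₁ hp₂).2 hne)).2 ⟨hp₁.squarefree, hp₂.squarefree⟩
  obtain ⟨e, he⟩ : ∃ e : ℤ, (p₁ : ℤ) * p₂ = 4 * e - 1 := by
    have h3 : (p₁ * p₂) % 4 = 3 := by rw [Nat.mul_mod, h₁, h₂]
    have h4 : (p₁ : ℤ) * p₂ = (p₁ * p₂ : ℕ) := by push_cast; rfl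
    exact ⟨(p₁ * p₂ : ℕ) / 4 + 1, by rw [h4]; lia⟩
  obtain ⟨ω, hω⟩ := exists_isQuadraticGenerator hsf (e := e) (by rw [← he]; push_cast; rfl)
  have hxodd : Odd x := by
    rw [← Int.odd_pow' two_ne_zero (n := 2)]
    exact ⟨2 * (w : ℤ) ^ 2 ^ (k + 1) - 2 * e, by linarith⟩
  obtain ⟨c, rfl⟩ := hxodd
  have hW : (w : ℤ) ^ 2 ^ (k + 1) = ((w : ℤ) ^ 2 ^ k) ^ 2 := by rw [← pow_mul, ← pow_succ]
  have hW2 : (2 : ℤ) ≤ (w : ℤ) ^ 2 ^ k :=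
    (by exact_mod_cast hw2 : (2 : ℤ) ≤ w).trans
      (le_self_pow₀ (by exact_mod_cast hw_pos) (pow_ne_zero _ two_ne_zero))
  -- With `W = w ^ 2 ^ k`, `4W² - x² ≥ 4W² - (2W - 2)² = 8W - 4 > 4W`.
  have hlt : 4 * (w : ℤ) ^ 2 ^ k < 4 * e - 1 := by
    rw [← he, h, hW]
    rw [abs_le] at hx
    nlinarith
  -- A common prime `q` would divide `x`, so `q²` would divide the squarefree `p₁p₂`.
  have hcop : w.Coprime (p₁ * p₂) := by
    by_contra hcon
    obtain ⟨q, hq, hqw, hqd⟩ := Nat.Prime.not_coprime_iff_dvd.1 hcon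
    have hqw' : (q : ℤ) ^ 2 ∣ 4 * (w : ℤ) ^ 2 ^ (k + 1) := by
      rw [hW]
      exact Dvd.dvd.mul_left (pow_dvd_pow_of_dvd ((Int.natCast_dvd_natCast.2 hqw).trans
        (dvd_pow_self _ (pow_ne_zero _ two_ne_zero))) 2) 4
    have hqd' : (q : ℤ) ∣ 4 * (w : ℤ) ^ 2 ^ (k + 1) - (2 * c + 1) ^ 2 := by
      rw [← h]
      exact_mod_cast hqd
    have hqx : (q : ℤ) ∣ 2 * c + 1 := (Nat.prime_iff_prime_int.1 hq).dvd_of_dvd_pow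
      ((dvd_sub_right ((dvd_pow_self _ two_ne_zero).trans hqw')).1 hqd')
    have hq2 : (q : ℤ) ^ 2 ∣ p₁ * p₂ := by
      rw [h]
      exact dvd_sub hqw' (pow_dvd_pow_of_dvd hqx 2)
    have hq2' : q * q ∣ p₁ * p₂ := by
      rw [sq] at hq2
      exact_mod_cast hq2
    exact hq.one_lt.ne' (Nat.isUnit_iff.1 (hsf q hq2'))
  exact isCyclic_and_card_sylow_iff hω hp₁ hp₂ h₁ h₂ he (c := c) hw2 (by linarith) hlt hcop P
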